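/- Let $m\ge 1$ be an integer and $\lambda=\frac12(1+\sqrt{4m+1})$. Consider the substitution $\varrho:\ 0\mapsto 01^m,\ 1\mapsto 0$, and let $w$ be the bi-infinite fixed point of $\varrho^2$ with seed $0|0$. Replacing $0$ and $1$ by intervals of length $\lambda$ and $1$, respectively, turns $w$ into a tiling of $\mathbb{R}$ with a tile of type $0$ beginning at the origin. Identify each tiling with the set $\varLambda=\varLambda^{(0)}\,\dot\cup\,\varLambda^{(1)}$ of left endpoints of its tiles, sorted by type, and let $\mathbb{Y}$ be the closure of the $\mathbb{R}$-translation orbit of the tiling defined by $w$ in the local topology. For $\varLambda\in\mathbb{Y}$ put $\varDelta_{ij}=\varLambda^{(j)}-\varLambda^{(i)}$, and let an index $r$ denote intersection with $[-r,r]$. Then, for all $i,j\in\{0,1\}$ and $z\in\mathbb{R}$, the pair correlation coefficient $$\nu_{ij}(z)=\lim_{r\to\infty}\frac{\operatorname{card}\bigl(\varLambda^{(i)}_r\cap(\varLambda^{(j)}_r-z)\bigr)}{\operatorname{card}(\varLambda_r)}$$ exists for every $\varLambda\in\mathbb{Y}$ and does not depend on $\varLambda$; it vanishes for $z\notin\varDelta_{ij}$.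 Moreover, with $$T=\begin{pmatrix}\{0\}&\{0\}\\ \{\lambda,\lambda+1,\dots,\lambda+m-1\}&\varnothing\end{pmatrix}$$ (rows and columns indexed by $0,1$), one has $$\nu_{ij}(z)=\frac1\lambda\sum_{k,\ell\in\{0,1\}}\ \sum_{r\in T_{ik}}\ \sum_{s\in T_{j\ell}}\nu_{k\ell}\Bigl(\frac{z+r-s}{\lambda}\Bigr)\qquad\text{for all } i,j\in\{0,1\},\ z\in\mathbb{R}.$$ In terms of the pair correlation measures $\varUpsilon_{ij}=\sum_{z\in\varDelta_{ij}}\nu_{ij}(z)\,\delta_z$, which are locally finite, and of the vector $\varUpsilon=(\varUpsilon_{00},\varUpsilon_{01},\varUpsilon_{10},\varUpsilon_{11})^T$, this is the convolution identity $$\varUpsilon=\frac1\lambda\Bigl(\widetilde{\delta_T}\overset{*}{\otimes}\delta_T\Bigr)*(f.\varUpsilon).$$ Here $f(x)=\lambda x$, $f.\mu=\mu\circ f^{-1}$, $\delta_T=\bigl(\sum_{x\in T_{ij}}\delta_x\bigr)_{ij}$, $\widetilde{\mu}$ is the reflection of a positive measure $\mu$ under $x\mapsto -x$ (taken entrywise),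 and $\overset{*}{\otimes}$ is the Kronecker product with convolution in the place of multiplication, so that $(A\overset{*}{\otimes}B)_{(ij),(k\ell)}=A_{ik}*B_{j\ell}$. -/

import Mathlib

open MeasureTheory Filter Topology

namespace BinaryInflation

/-- The inflation multiplier `(1 + √(4m+1)) / 2`. -/
noncomputable def lam (m : ℕ) : ℝ := (1 + Real.sqrt (4 * (m : ℝ) + 1)) / 2

/-- The substitution `0 ↦ 0 1^m`, `1 ↦ 0` on letters. -/
def substLetter (m : ℕ) (a : Fin 2) : List (Fin 2) :=
  if a = 0 then 0 :: List.replicate m 1 else [0]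

/-- The substitution on finite words. -/
def substWord (m : ℕ) (u : List (Fin 2)) : List (Fin 2) := u.flatMap (substLetter m)

/-- The bi-infinite fixed point of the square of the substitution with seed `0|0`. For `m ≥ 1` the
square maps `0` to a word that begins and ends with `0`, so the words `ϱ^(2n)(0)` are prefixes, and
also suffixes, of one another. Letter `n ≥ 0` is the letter at place `n` of these words, and letter
`-(n+1)` is the letter at place `n` counted from the end (`2n+2` iterations give more than `n`
letters, so the default value of `getD` is never used). -/
def fixedWord (m : ℕ) : ℤ → Fin 2
  | Int.ofNat n => ((substWord m)^[2 * (n + 1)] [0]).getD n 0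
  | Int.negSucc n => ((substWord m)^[2 * (n + 1)] [0]).reverse.getD n 0

/-- Natural tile lengths: `λ` for type `0` and `1` for type `1`. -/
noncomputable def tileLength (m : ℕ) (a : Fin 2) : ℝ := if a = 0 then lam m else 1

/-- The left endpoint of tile number `n` of the tiling defined by `fixedWord m`, where tile `0`
begins at the origin. -/
noncomputable def tilePos (m : ℕ) : ℤ → ℝ
  | Int.ofNat n => ∑ k ∈ Finset.range n, tileLength m (fixedWord m (Int.ofNat k))
  | Int.negSucc n => -∑ k ∈ Finset.range (n + 1), tileLength m (fixedWord m (Int.negSucc k))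

/-- A typed point set `Λ = Λ⁰ ∪ Λ¹`, given by its points of type `0` and of type `1`. -/
abbrev TypedSet : Type := Fin 2 → Set ℝ

/-- The left endpoints of the tiles, by type, of the tiling defined by `fixedWord m`. -/
def fixedTiling (m : ℕ) : TypedSet := fun i => {x | ∃ n : ℤ, fixedWord m n = i ∧ tilePos m n = x}

/-- The translate `t + Λ`. -/
def translate (t : ℝ) (L : TypedSet) : TypedSet := fun i => (fun x => t + x) '' L i

/-- Closeness in the local topology: up to a translation by at most `ε`, the two sets agree on
`[-1/ε, 1/ε]`. -/
def LocallyClose (ε : ℝ) (L L' : TypedSet) : Prop :=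
  ∃ s : ℝ, |s| ≤ ε ∧
    ∀ i, translate s L i ∩ Set.Icc (-(1 / ε)) (1 / ε) = L' i ∩ Set.Icc (-(1 / ε)) (1 / ε)

/-- The tiling hull `𝕐_m`: the closure, in the local topology, of the translation orbit of the
tiling defined by the fixed point (each tiling being identified with its typed left endpoints). -/
def hull (m : ℕ) : Set TypedSet :=
  {L | ∀ ε : ℝ, 0 < ε → ∃ t : ℝ, LocallyClose ε L (translate t (fixedTiling m))}

/-- `S_r = S ∩ [-r, r]`. -/
def cut (r : ℝ) (S : Set ℝ) : Set ℝ := S ∩ Set.Icc (-r) r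

/-- The quotient `card (Λⁱ_r ∩ (Λʲ_r - z)) / card Λ_r`. -/
noncomputable def pairRatio (L : TypedSet) (i j : Fin 2) (z r : ℝ) : ℝ :=
  ((cut r (L i) ∩ (fun x => x - z) '' cut r (L j)).ncard : ℝ) / ((cut r (⋃ k, L k)).ncard : ℝ)

/-- `ν` is the family of pair correlation coefficients of the hull: for every element of the hull,
all the relative pair frequencies exist as limits and are given by the same `ν`. -/
def IsPairCorrelation (m : ℕ) (ν : Fin 2 → Fin 2 → ℝ → ℝ) : Prop :=
  ∀ L ∈ hull m, ∀ (i j : Fin 2) (z : ℝ), Tendsto (pairRatio L i j z) atTop (𝓝 (ν i j z))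

/-- The difference set `Δ_ij = Λʲ - Λⁱ`. -/
def diffSet (L : TypedSet) (i j : Fin 2) : Set ℝ := {z | ∃ x ∈ L i, ∃ y ∈ L j, z = y - x}

/-- The displacement matrix: the entry `(i, j)` is the set of relative positions of tiles of type
`i` in supertiles of type `j`. -/
noncomputable def T (m : ℕ) : Matrix (Fin 2) (Fin 2) (Finset ℝ) :=
  !![{0}, {0}; (Finset.range m).image (fun a : ℕ => lam m + (a : ℝ)), ∅]

/-- The measure matrix `δ_T`, with entries `δ_{T_ij} = ∑ x ∈ T_ij, δ_x`. -/
noncomputable def deltaT (m : ℕ) : Matrix (Fin 2) (Fin 2) (Measure ℝ) :=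
  fun i j => ∑ x ∈ T m i j, Measure.dirac x

/-- The reflected matrix. For a positive measure, `μ̃` is the image of `μ` under `x ↦ -x`. -/
noncomputable def tilde (A : Matrix (Fin 2) (Fin 2) (Measure ℝ)) :
    Matrix (Fin 2) (Fin 2) (Measure ℝ) :=
  fun i j => (A i j).map (fun x => -x)

/-- The Kronecker convolution product of matrices of measures: the Kronecker product with
convolution in the place of multiplication. -/
noncomputable def kroneckerConv (A B : Matrix (Fin 2) (Fin 2) (Measure ℝ)) :
    Matrix (Fin 2 × Fin 2) (Fin 2 × Fin 2) (Measure ℝ) :=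
  fun p q => (A p.1 q.1).conv (B p.2 q.2)

/-- The convolution of a matrix of measures with a vector of measures. -/
noncomputable def convVec (A : Matrix (Fin 2 × Fin 2) (Fin 2 × Fin 2) (Measure ℝ))
    (v : Fin 2 × Fin 2 → Measure ℝ) : Fin 2 × Fin 2 → Measure ℝ :=
  fun p => ∑ q, (A p q).conv (v q)

/-- The pair correlation measure vector, `Υ_ij = ∑ z ∈ Δ_ij, ν_ij(z) δ_z`. -/
noncomputable def pairMeasure (ν : Fin 2 → Fin 2 → ℝ → ℝ) (L : TypedSet) :
    Fin 2 × Fin 2 → Measure ℝ :=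
  fun p => Measure.sum fun z : diffSet L p.1 p.2 =>
    ENNReal.ofReal (ν p.1 p.2 (z : ℝ)) • Measure.dirac (z : ℝ)

/-- The image `f.Υ` of a vector of measures under `f`. -/
noncomputable def mapVec (f : ℝ → ℝ) (v : Fin 2 × Fin 2 → Measure ℝ) :
    Fin 2 × Fin 2 → Measure ℝ :=
  fun p => (v p).map f

end BinaryInflation

/-! Pair counts and tile counts of finite patches are additive under concatenation up to a bounded
error (`pairCount_append`, `tileCount_patch`): an extra pair must straddle the seam, and tiles have
length at least 1. Seam errors stay bounded while lengths grow by λ with each inflation, so such a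
functional has a density along ϱⁿ(0), and then uniformly along all words ϱⁿ(v) (`exists_density`,
`eventually_abs_sub_le`). Every window of every element of the hull is cut from a patch of some
ϱⁿ(v) (`hull_window`), and monotonicity traps its count between those of two words of level-n
supertiles (`window_estimate`). Hence the densities exist throughout the hull and agree there; ν is
the pair density divided by the positive tile density.

The renormalisation relation is an exact identity before the limit (`pairCount_substWord`): a tile
of ϱ(u) lies at λy + r for exactly one tile y of u and one r in `T`, so a pair at distance z comes
from one pair of supertiles at distance (z + r - s)/λ. As u is given, no recognisability result is
involved.

The measure identity follows by comparing atoms, since both sides are carried by a countable set.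
Local finiteness holds because differences have the form ±(kλ + l) with natural k, l. -/

namespace BinaryInflation

/-! ### The inflation multiplier and the tile lengths. -/

section Multiplier

theorem lam_sq (m : ℕ) : lam m * lam m = lam m + m := by
  have h : Real.sqrt (4 * (m : ℝ) + 1) * Real.sqrt (4 * (m : ℝ) + 1) = 4 * m + 1 :=
    Real.mul_self_sqrt (by positivity)
  unfold lam
  linarith

theorem one_le_lam (m : ℕ) : 1 ≤ lam m := by
  have h : 1 ≤ Real.sqrt (4 * (m : ℝ) + 1) := Real.one_le_sqrt.2 (by linarith [m.cast_nonneg (α := ℝ)])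
  unfold lam
  linarith

theorem lam_pos (m : ℕ) : 0 < lam m := zero_lt_one.trans_le (one_le_lam m)

theorem one_lt_lam {m : ℕ} (hm : 1 ≤ m) : 1 < lam m := by
  have h := lam_sq m
  have h1 := one_le_lam m
  have hm' : (1 : ℝ) ≤ m := by exact_mod_cast hm
  nlinarith

theorem one_le_tileLength (m : ℕ) (a : Fin 2) : 1 ≤ tileLength m a := by
  unfold tileLength
  split_ifs
  · exact one_le_lam m
  · exact le_rfl

theorem tileLength_le (m : ℕ) (a : Fin 2) : tileLength m a ≤ lam m := by
  unfold tileLength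
  split_ifs
  · exact le_rfl
  · exact one_le_lam m

@[simp] theorem tileLength_zero (m : ℕ) : tileLength m 0 = lam m := by simp [tileLength]

@[simp] theorem tileLength_one (m : ℕ) : tileLength m 1 = 1 := by simp [tileLength]

end Multiplier

/-! ### Geometric length of words under substitution. -/

section Words

/-- The geometric length of a word. -/
noncomputable def wordLength (m : ℕ) (u : List (Fin 2)) : ℝ := (u.map (tileLength m)).sum

@[simp] theorem wordLength_nil (m : ℕ) : wordLength m [] = 0 := by simp [wordLength]

@[simp] theorem wordLength_cons (m : ℕ) (a : Fin 2) (u : List (Fin 2)) :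
    wordLength m (a :: u) = tileLength m a + wordLength m u := by simp [wordLength]

@[simp] theorem wordLength_append (m : ℕ) (u v : List (Fin 2)) :
    wordLength m (u ++ v) = wordLength m u + wordLength m v := by simp [wordLength]

theorem length_le_wordLength (m : ℕ) (u : List (Fin 2)) : (u.length : ℝ) ≤ wordLength m u := by
  induction u with
  | nil => simp
  | cons a u ih => simp; linarith [one_le_tileLength m a]

theorem wordLength_le (m : ℕ) (u : List (Fin 2)) : wordLength m u ≤ lam m * u.length := by
  induction u with
  | nil => simp
  | cons a u ih => simp; linarith [tileLength_le m a]

theorem wordLength_nonneg (m : ℕ) (u : List (Fin 2)) : 0 ≤ wordLength m u :=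
  (Nat.cast_nonneg _).trans (length_le_wordLength m u)

theorem wordLength_replicate_one (m k : ℕ) : wordLength m (List.replicate k 1) = k := by
  simp [wordLength]

theorem wordLength_substLetter (m : ℕ) (a : Fin 2) :
    wordLength m (substLetter m a) = lam m * tileLength m a := by
  fin_cases a
  · simp [substLetter, wordLength_replicate_one, lam_sq]
  · simp [substLetter]

@[simp] theorem substWord_nil (m : ℕ) : substWord m [] = [] := rfl

theorem substWord_cons (m : ℕ) (a : Fin 2) (u : List (Fin 2)) :
    substWord m (a :: u) = substLetter m a ++ substWord m u := by simp [substWord]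

theorem substWord_append (m : ℕ) (u v : List (Fin 2)) :
    substWord m (u ++ v) = substWord m u ++ substWord m v := by simp [substWord]

theorem wordLength_substWord (m : ℕ) (u : List (Fin 2)) :
    wordLength m (substWord m u) = lam m * wordLength m u := by
  induction u with
  | nil => simp
  | cons a u ih => simp [substWord_cons, wordLength_substLetter, ih, mul_add]

theorem substWord_iterate_nil (m n : ℕ) : (substWord m)^[n] [] = [] := by
  induction n with
  | zero => rfl
  | succ n ih => rw [Function.iterate_succ_apply, substWord_nil, ih]

theorem substWord_iterate_append (m n : ℕ) (u v : List (Fin 2)) :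
    (substWord m)^[n] (u ++ v) = (substWord m)^[n] u ++ (substWord m)^[n] v := by
  induction n generalizing u v with
  | zero => rfl
  | succ n ih => simp only [Function.iterate_succ_apply, substWord_append, ih]

theorem wordLength_substWord_iterate (m n : ℕ) (u : List (Fin 2)) :
    wordLength m ((substWord m)^[n] u) = lam m ^ n * wordLength m u := by
  induction n with
  | zero => simp
  | succ n ih => rw [Function.iterate_succ_apply', wordLength_substWord, ih]; ring

end Words

/-! ### Patches of finite words, their differences and their inflation. -/

section Patches

/-- The typed left endpoints of the tiles of a finite word whose first tile begins at `x`. -/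
def patch (m : ℕ) : List (Fin 2) → ℝ → TypedSet
  | [], _ => fun _ => ∅
  | a :: u, x => fun i => {y | i = a ∧ y = x} ∪ patch m u (x + tileLength m a) i

theorem patch_append (m : ℕ) (u v : List (Fin 2)) (x : ℝ) (i : Fin 2) :
    patch m (u ++ v) x i = patch m u x i ∪ patch m v (x + wordLength m u) i := by
  induction u generalizing x with
  | nil => simp [patch]
  | cons a u ih => simp [patch, ih, Set.union_assoc, add_assoc]

theorem translate_patch (m : ℕ) (u : List (Fin 2)) (t x : ℝ) :
    translate t (patch m u x) = patch m u (t + x) := by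
  funext i
  induction u generalizing x with
  | nil => simp [patch, translate]
  | cons a u ih =>
    have h := ih (x + tileLength m a)
    simp only [translate] at h
    simp only [patch, translate, Set.image_union, h, add_assoc]
    congr 1
    ext y
    constructor
    · rintro ⟨z, ⟨h1, rfl⟩, rfl⟩
      exact ⟨h1, rfl⟩
    · rintro ⟨h1, rfl⟩
      exact ⟨x, ⟨h1, rfl⟩, rfl⟩

theorem patch_finite (m : ℕ) (u : List (Fin 2)) (x : ℝ) (i : Fin 2) : (patch m u x i).Finite := by
  induction u generalizing x with
  | nil => simp [patch]
  | cons a u ih =>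
    exact Set.Finite.union ((Set.finite_singleton x).subset fun y hy => hy.2) (ih _)

theorem mem_patch_bounds {m : ℕ} {u : List (Fin 2)} {x y : ℝ} {i : Fin 2}
    (h : y ∈ patch m u x i) : x ≤ y ∧ y + tileLength m i ≤ x + wordLength m u := by
  induction u generalizing x with
  | nil => exact h.elim
  | cons a u ih =>
    have h1 := one_le_tileLength m a
    have h2 := wordLength_nonneg m u
    rw [wordLength_cons]
    rcases h with ⟨rfl, rfl⟩ | h
    · constructor <;> linarith
    · obtain ⟨h3, h4⟩ := ih h
      constructor <;> linarith

theorem patch_separated {m : ℕ} {u : List (Fin 2)} {x y z : ℝ} {i j : Fin 2}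
    (hy : y ∈ patch m u x i) (hz : z ∈ patch m u x j) :
    (y = z ∧ i = j) ∨ y + tileLength m i ≤ z ∨ z + tileLength m j ≤ y := by
  induction u generalizing x with
  | nil => exact hy.elim
  | cons a u ih =>
    rcases hy with ⟨rfl, rfl⟩ | hy <;> rcases hz with ⟨rfl, rfl⟩ | hz
    · exact Or.inl ⟨rfl, rfl⟩
    · exact Or.inr (Or.inl (mem_patch_bounds hz).1)
    · exact Or.inr (Or.inr (mem_patch_bounds hy).1)
    · exact ih hy hz

/-- The sums of tile lengths and their negatives. -/
def signedLengths (m : ℕ) : Set ℝ :=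
  Set.range (fun p : ℕ × ℕ => p.1 * lam m + p.2) ∪
    Set.range fun p : ℕ × ℕ => -(p.1 * lam m + p.2)

theorem exists_nat_of_mem_patch {m : ℕ} {u : List (Fin 2)} {x y : ℝ} {i : Fin 2}
    (h : y ∈ patch m u x i) : ∃ p : ℕ × ℕ, y - x = p.1 * lam m + p.2 := by
  induction u generalizing x with
  | nil => exact h.elim
  | cons a u ih =>
    rcases h with ⟨rfl, rfl⟩ | h
    · exact ⟨(0, 0), by simp⟩
    · obtain ⟨⟨k, l⟩, hp⟩ := ih h
      fin_cases a
      · refine ⟨(k + 1, l), ?_⟩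
        simp at hp ⊢
        linarith
      · refine ⟨(k, l + 1), ?_⟩
        simp at hp ⊢
        linarith

theorem sub_mem_signedLengths {m : ℕ} {u : List (Fin 2)} {x y z : ℝ} {i j : Fin 2}
    (hy : y ∈ patch m u x i) (hz : z ∈ patch m u x j) : z - y ∈ signedLengths m := by
  induction u generalizing x with
  | nil => exact hy.elim
  | cons a u ih =>
    rcases id hy with ⟨-, rfl⟩ | hy'
    · obtain ⟨p, hp⟩ := exists_nat_of_mem_patch hz
      exact Or.inl ⟨p, hp.symm⟩
    · rcases id hz with ⟨-, rfl⟩ | hz'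
      · obtain ⟨p, hp⟩ := exists_nat_of_mem_patch hy
        refine Or.inr ⟨p, ?_⟩
        simp only [← hp]
        ring
      · exact ih hy' hz'

theorem signedLengths_countable (m : ℕ) : (signedLengths m).Countable :=
  (Set.countable_range _).union (Set.countable_range _)

/-- Both coefficients carry the same sign, so a bound on the sum bounds each of them. With mixed
signs the values would be dense whenever λ is irrational. -/
theorem signedLengths_inter_finite (m : ℕ) (R : ℝ) :
    (signedLengths m ∩ Set.Icc (-R) R).Finite := by
  obtain ⟨N, hN⟩ := exists_nat_ge R
  have hfin : (Set.Iic N ×ˢ Set.Iic N : Set (ℕ × ℕ)).Finite :=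
    (Set.finite_Iic N).prod (Set.finite_Iic N)
  refine ((hfin.image fun p : ℕ × ℕ => (p.1 : ℝ) * lam m + p.2).union
    (hfin.image fun p : ℕ × ℕ => -((p.1 : ℝ) * lam m + p.2))).subset ?_
  have key : ∀ p : ℕ × ℕ, (p.1 : ℝ) * lam m + p.2 ≤ R → p ∈ (Set.Iic N ×ˢ Set.Iic N) := by
    rintro ⟨k, l⟩ h
    have h1 := one_le_lam m
    have hk : (0 : ℝ) ≤ k := k.cast_nonneg
    have hl : (0 : ℝ) ≤ l := l.cast_nonneg
    simp only at h
    constructor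
    · have : (k : ℝ) ≤ N := by nlinarith
      exact_mod_cast this
    · have : (l : ℝ) ≤ N := by nlinarith
      exact_mod_cast this
  rintro y ⟨⟨p, rfl⟩ | ⟨p, rfl⟩, hy1, hy2⟩
  · exact Or.inl ⟨p, key p hy2, rfl⟩
  · exact Or.inr ⟨p, key p (by linarith), rfl⟩

theorem patch_replicate_one (m k : ℕ) (x : ℝ) (i : Fin 2) :
    patch m (List.replicate k 1) x i = {y | i = 1 ∧ ∃ a < k, y = x + (a : ℝ)} := by
  induction k generalizing x with
  | zero => simp [patch]
  | succ k ih =>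
    rw [List.replicate_succ]
    simp only [patch, ih, tileLength_one]
    ext y
    constructor
    · rintro (⟨h, rfl⟩ | ⟨h, a, ha, rfl⟩)
      · exact ⟨h, 0, by omega, by simp⟩
      · exact ⟨h, a + 1, by omega, by push_cast; ring⟩
    · rintro ⟨h, a, ha, rfl⟩
      rcases a with - | a
      · exact Or.inl ⟨h, by simp⟩
      · exact Or.inr ⟨h, a, by omega, by push_cast; ring⟩

theorem patch_substLetter (m : ℕ) (a : Fin 2) (x : ℝ) (i : Fin 2) :
    patch m (substLetter m a) x i = {y | ∃ r ∈ T m i a, y = x + r} := by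
  ext y
  fin_cases a <;> fin_cases i <;>
    simp [substLetter, patch, patch_replicate_one, T, add_assoc]

theorem patch_substWord (m : ℕ) (u : List (Fin 2)) (x : ℝ) (i : Fin 2) :
    patch m (substWord m u) (lam m * x) i =
      {y | ∃ k, ∃ r ∈ T m i k, ∃ x' ∈ patch m u x k, y = lam m * x' + r} := by
  induction u generalizing x with
  | nil => simp [patch]
  | cons a u ih =>
    rw [substWord_cons, patch_append, wordLength_substLetter, ← mul_add, ih, patch_substLetter]
    ext y
    constructor
    · rintro (⟨r, hr, rfl⟩ | ⟨k, r, hr, x', hx', rfl⟩)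
      · exact ⟨a, r, hr, x, Or.inl ⟨rfl, rfl⟩, rfl⟩
      · exact ⟨k, r, hr, x', Or.inr hx', rfl⟩
    · rintro ⟨k, r, hr, x', ⟨rfl, rfl⟩ | hx', rfl⟩
      · exact Or.inl ⟨r, hr, rfl⟩
      · exact Or.inr ⟨k, r, hr, x', hx', rfl⟩

/-- The offset is the left endpoint of a tile contained in the supertile of `k`; that tile has
positive length, whence the strict inequality. -/
theorem T_bounds {m : ℕ} {i k : Fin 2} {r : ℝ} (hr : r ∈ T m i k) :
    0 ≤ r ∧ r < lam m * tileLength m k := by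
  have h : lam m * 0 + r ∈ patch m (substWord m [k]) (lam m * 0) i := by
    rw [patch_substWord]
    exact ⟨k, r, hr, 0, Or.inl ⟨rfl, rfl⟩, rfl⟩
  have h1 := mem_patch_bounds h
  have h2 := one_le_tileLength m i
  rw [wordLength_substWord] at h1
  simp at h1
  constructor <;> linarith

/-- Distinct tiles of `u` inflate to disjoint half-open supertiles, so a point determines its
supertile and its offset. -/
theorem patch_inflate_injective {m : ℕ} {u : List (Fin 2)} {x y z r s : ℝ} {i k l : Fin 2}
    (hr : r ∈ T m i k) (hs : s ∈ T m i l) (hy : y ∈ patch m u x k) (hz : z ∈ patch m u x l)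
    (h : lam m * y + r = lam m * z + s) : k = l ∧ r = s ∧ y = z := by
  have hr' := T_bounds hr
  have hs' := T_bounds hs
  have h0 := lam_pos m
  rcases patch_separated hy hz with ⟨rfl, rfl⟩ | h1 | h1
  · exact ⟨rfl, by linarith, rfl⟩
  · have := mul_le_mul_of_nonneg_left h1 h0.le
    linarith
  · have := mul_le_mul_of_nonneg_left h1 h0.le
    linarith

end Patches

/-! ### Densities of almost additive functionals along inflated words. -/

section AlmostAdditive

theorem tendsto_zero_of_le_add_mul {e d : ℕ → ℝ} {q : ℝ} (hq0 : 0 ≤ q) (hq1 : q < 1)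
    (hd : Tendsto d atTop (𝓝 0)) (he : ∀ n, |e (n + 1)| ≤ d n + q * |e n|) :
    Tendsto e atTop (𝓝 0) := by
  rw [Metric.tendsto_atTop]
  intro ε hε
  have h1q : 0 < 1 - q := by linarith
  -- Once `d` is below this value, the recursion keeps the bound `ε / 2`, and only the initial
  -- error, decaying like `q ^ k`, is left.
  have hpos : 0 < (1 - q) * (ε / 2) := by positivity
  obtain ⟨N, hN⟩ := eventually_atTop.1 (hd.eventually (gt_mem_nhds hpos))
  have key : ∀ k, |e (N + k)| ≤ ε / 2 + q ^ k * |e N| := by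
    intro k
    induction k with
    | zero => simp; linarith
    | succ k ih =>
      have h1 := he (N + k)
      have h2 := hN (N + k) (by omega)
      have h3 := mul_le_mul_of_nonneg_left ih hq0
      rw [← add_assoc, pow_succ]
      linarith
  have hlim : Tendsto (fun k => q ^ k * |e N|) atTop (𝓝 0) := by
    simpa using (tendsto_pow_atTop_nhds_zero_of_lt_one hq0 hq1).mul_const |e N|
  obtain ⟨K, hK⟩ := eventually_atTop.1 (hlim.eventually (gt_mem_nhds (half_pos hε)))
  refine ⟨N + K, fun n hn => ?_⟩
  obtain ⟨k, rfl⟩ := Nat.exists_eq_add_of_le hn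
  have h1 := key (K + k)
  have h2 := hK (K + k) (by omega)
  rw [Real.dist_eq, sub_zero, add_assoc]
  linarith

variable {m : ℕ} {f : List (Fin 2) → ℝ} {C η : ℝ}

/-- Errors arise only at seams between images of letters of `v`, so the bound does not depend on
`n`. The extra 1 covers the empty word, where additivity reads `|f []| ≤ C`. -/
theorem abs_sub_sum_le (hf : ∀ u v, |f (u ++ v) - f u - f v| ≤ C) (n : ℕ) (v : List (Fin 2)) :
    |f ((substWord m)^[n] v) - (v.map fun a => f ((substWord m)^[n] [a])).sum| ≤
      C * (v.length + 1) := by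
  induction v with
  | nil =>
    have h := hf [] []
    rw [substWord_iterate_nil]
    simp at h ⊢
    exact h
  | cons a v ih =>
    have h := hf ((substWord m)^[n] [a]) ((substWord m)^[n] v)
    rw [← substWord_iterate_append] at h
    simp only [List.map_cons, List.sum_cons, List.length_cons, List.singleton_append] at h ⊢
    push_cast
    rw [abs_le] at *
    constructor <;> linarith

/-- Up to a bounded error, a_n = f(ϱⁿ(0)) satisfies a_{n+2} = a_{n+1} + m a_n, with characteristic
roots λ and 1 - λ. The second root need not be small; it suffices that (λ - 1)/λ < 1. -/
theorem exists_density (hm : 1 ≤ m) (hf : ∀ u v, |f (u ++ v) - f u - f v| ≤ C) :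
    ∃ η, Tendsto (fun n => f ((substWord m)^[n] [0]) / lam m ^ (n + 1)) atTop (𝓝 η) := by
  have hl := one_lt_lam hm
  have hl0 := lam_pos m
  set x : ℕ → ℝ := fun n => f ((substWord m)^[n] [0]) / lam m ^ (n + 1) with hx
  -- This is (a_{n+1} + (λ - 1)a_n)/λ^{n+1}, the combination eliminating the root 1 - λ; as m = λ(λ
  -- - 1), its increments decay geometrically.
  set b : ℕ → ℝ := fun n => lam m * x (n + 1) + (lam m - 1) * x n with hb
  have hstep : ∀ n, |f ((substWord m)^[n + 2] [0]) - f ((substWord m)^[n + 1] [0])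
      - m * f ((substWord m)^[n] [0])| ≤ C * (m + 2) := by
    intro n
    have h := abs_sub_sum_le (m := m) hf (n + 1) (0 :: List.replicate m 1)
    have h0 : (substWord m)^[n + 2] [0] = (substWord m)^[n + 1] (0 :: List.replicate m 1) := by
      rw [Function.iterate_succ_apply]
      simp [substWord, substLetter]
    have h1 : (substWord m)^[n + 1] [1] = (substWord m)^[n] [0] := by
      rw [Function.iterate_succ_apply]
      simp [substWord, substLetter]
    simp only [List.map_cons, List.map_replicate, List.sum_cons, List.sum_replicate, h1,
      List.length_cons, List.length_replicate, nsmul_eq_mul, ← h0] at h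
    push_cast at h
    rw [show (m : ℝ) + 1 + 1 = m + 2 by ring] at h
    rwa [sub_sub]
  have hbstep : ∀ n, dist (b n) (b (n + 1)) ≤ C * (m + 2) * (1 / lam m) ^ n := by
    intro n
    have h := hstep n
    have hC : 0 ≤ C * (m + 2) := (abs_nonneg _).trans h
    have heq : b (n + 1) - b n = (f ((substWord m)^[n + 2] [0]) - f ((substWord m)^[n + 1] [0])
        - m * f ((substWord m)^[n] [0])) / lam m ^ (n + 2) := by
      have hm' : (m : ℝ) = lam m * lam m - lam m := by linarith [lam_sq m]
      simp only [hb, hx, hm']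
      field_simp
      ring
    rw [dist_comm, Real.dist_eq, heq, abs_div, abs_of_pos (pow_pos hl0 _), one_div, inv_pow,
      ← div_eq_mul_inv]
    exact div_le_div₀ hC h (pow_pos hl0 _) (pow_le_pow_right₀ hl.le (by omega))
  obtain ⟨β, hβ⟩ := cauchySeq_tendsto_of_complete
    (cauchySeq_of_le_geometric _ _ ((div_lt_one hl0).2 hl) hbstep)
  have h2 : 0 < 2 * lam m - 1 := by linarith
  -- The fixed point of x = β/λ - ((λ - 1)/λ)x, the limiting form of the definition of `b`.
  refine ⟨β / (2 * lam m - 1), ?_⟩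
  rw [← tendsto_sub_nhds_zero_iff]
  have hd : Tendsto (fun n => |b n - β| / lam m) atTop (𝓝 0) := by
    simpa using ((tendsto_sub_nhds_zero_iff.2 hβ).abs).div_const (lam m)
  refine tendsto_zero_of_le_add_mul (q := (lam m - 1) / lam m)
    (div_nonneg (by linarith) hl0.le) ((div_lt_one hl0).2 (by linarith)) hd fun n => ?_
  have heq : x (n + 1) - β / (2 * lam m - 1) =
      (b n - β) / lam m + -((lam m - 1) / lam m * (x n - β / (2 * lam m - 1))) := by
    simp only [hb]
    field_simp
    ring
  rw [heq]
  refine (abs_add_le _ _).trans_eq ?_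
  rw [abs_neg, abs_mul, abs_div, abs_div, abs_of_pos hl0,
    abs_of_nonneg (by linarith : 0 ≤ lam m - 1)]

/-- The point is uniformity in `v`. Both letters have the same density per length, because ϱⁿ⁺¹(1) =
ϱⁿ(0). -/
theorem eventually_abs_sub_le (hm : 1 ≤ m) (hf : ∀ u v, |f (u ++ v) - f u - f v| ≤ C)
    (hη : Tendsto (fun n => f ((substWord m)^[n] [0]) / lam m ^ (n + 1)) atTop (𝓝 η))
    {ε : ℝ} (hε : 0 < ε) : ∀ᶠ n in atTop, ∀ v : List (Fin 2),
      |f ((substWord m)^[n] v) - η * (lam m ^ n * wordLength m v)| ≤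
        ε * (lam m ^ n * wordLength m v) + C := by
  have hl0 := lam_pos m
  have hC : 0 ≤ C := (abs_nonneg _).trans (hf [] [])
  have hη1 : Tendsto (fun n => f ((substWord m)^[n] [1]) / lam m ^ n) atTop (𝓝 η) := by
    rw [← tendsto_add_atTop_iff_nat 1]
    refine hη.congr fun n => ?_
    rw [Function.iterate_succ_apply]
    simp [substWord, substLetter]
  have hC0 : Tendsto (fun n => C / lam m ^ n) atTop (𝓝 0) :=
    tendsto_const_nhds.div_atTop (tendsto_pow_atTop_atTop_of_one_lt (one_lt_lam hm))
  have hε2 : 0 < ε / 2 := half_pos hε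
  filter_upwards [(Metric.tendsto_nhds.1 hη) _ hε2, (Metric.tendsto_nhds.1 hη1) _ hε2,
    hC0.eventually (gt_mem_nhds hε2)] with n h0 h1 h2 v
  have hp : 0 < lam m ^ n := pow_pos hl0 n
  have hletter : ∀ a : Fin 2, |f ((substWord m)^[n] [a]) - η * (lam m ^ n * tileLength m a)| ≤
      ε / 2 * (lam m ^ n * tileLength m a) := by
    intro a
    have hq : 0 < lam m ^ n * tileLength m a :=
      mul_pos hp (zero_lt_one.trans_le (one_le_tileLength m a))
    have h : |f ((substWord m)^[n] [a]) / (lam m ^ n * tileLength m a) - η| < ε / 2 := by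
      fin_cases a
      · simpa [Real.dist_eq, pow_succ] using h0
      · simpa [Real.dist_eq] using h1
    rw [div_sub' hq.ne', abs_div, abs_of_pos hq, div_lt_iff₀ hq] at h
    rw [mul_comm η]
    exact h.le
  have hsum : |(v.map fun a => f ((substWord m)^[n] [a])).sum - η * (lam m ^ n * wordLength m v)| ≤
      ε / 2 * (lam m ^ n * wordLength m v) := by
    induction v with
    | nil => simp
    | cons a v ih =>
      have h := hletter a
      simp only [List.map_cons, List.sum_cons, wordLength_cons]
      rw [abs_le] at *
      constructor <;> nlinarith
  have h3 := abs_sub_sum_le (m := m) hf n v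
  -- One seam error per letter is negligible against the length of an inflated letter, at least λⁿ.
  have h4 : C * v.length ≤ ε / 2 * (lam m ^ n * wordLength m v) := by
    rw [div_lt_iff₀ hp] at h2
    have h5 := mul_le_mul h2.le (length_le_wordLength m v) (Nat.cast_nonneg _) (by positivity)
    linarith
  rw [abs_le] at *
  constructor <;> linarith

end AlmostAdditive

/-! ### Trapping windows between words of supertiles. -/

section Windows

theorem exists_split_le (m : ℕ) (v : List (Fin 2)) {y : ℝ} (h0 : 0 ≤ y)
    (hy : y ≤ wordLength m v) : ∃ p q, v = p ++ q ∧ wordLength m p ≤ y ∧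
      y ≤ wordLength m p + lam m := by
  induction v generalizing y with
  | nil =>
    simp at hy
    exact ⟨[], [], rfl, by simpa using h0, by simp; linarith [lam_pos m]⟩
  | cons a v ih =>
    have ha := tileLength_le m a
    rw [wordLength_cons] at hy
    by_cases h : y < tileLength m a
    · exact ⟨[], a :: v, rfl, by simpa using h0, by simp; linarith⟩
    · obtain ⟨p, q, rfl, h1, h2⟩ := ih (y := y - tileLength m a) (by linarith) (by linarith)
      exact ⟨a :: p, q, rfl, by simp; linarith, by simp; linarith⟩

theorem exists_split_gt (m : ℕ) (v : List (Fin 2)) {y : ℝ} (h0 : 0 ≤ y)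
    (hy : y < wordLength m v) : ∃ p q, v = p ++ q ∧ y < wordLength m p ∧
      wordLength m p ≤ y + lam m := by
  induction v generalizing y with
  | nil =>
    simp at hy
    linarith
  | cons a v ih =>
    have ha := tileLength_le m a
    rw [wordLength_cons] at hy
    by_cases h : y < tileLength m a
    · exact ⟨[a], v, rfl, by simpa using h, by simp; linarith⟩
    · obtain ⟨p, q, rfl, h1, h2⟩ := ih (y := y - tileLength m a) (by linarith) (by linarith)
      exact ⟨a :: p, q, rfl, by simp; linarith, by simp; linarith⟩

/-- Cutting a typed point set. -/
def cutTyped (r : ℝ) (L : TypedSet) : TypedSet := fun i => cut r (L i)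

/-- Rounding the window outwards to supertile boundaries costs at most one level-n supertile, of
length at most λ^{n+1}, at each end. -/
theorem exists_outer_word {m n : ℕ} {v : List (Fin 2)} {x r : ℝ} (hr : 0 ≤ r) (hx : x ≤ -r)
    (hv : r < x + lam m ^ n * wordLength m v) : ∃ q y,
      lam m ^ n * wordLength m q ≤ 2 * r + 2 * lam m ^ (n + 1) ∧
      2 * r ≤ lam m ^ n * wordLength m q ∧
      ∀ i, cutTyped r (patch m ((substWord m)^[n] v) x) i ⊆ patch m ((substWord m)^[n] q) y i := by
  have hp : 0 < lam m ^ n := pow_pos (lam_pos m) n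
  obtain ⟨p, w, rfl, h1, h2⟩ := exists_split_le m v (y := (-r - x) / lam m ^ n)
    (div_nonneg (by linarith) hp.le) (by rw [div_le_iff₀ hp]; linarith)
  rw [le_div_iff₀ hp] at h1
  rw [div_le_iff₀ hp] at h2
  rw [wordLength_append] at hv
  obtain ⟨q, s, rfl, h3, h4⟩ := exists_split_gt m w
    (y := (r - x - lam m ^ n * wordLength m p) / lam m ^ n)
    (div_nonneg (by linarith) hp.le) (by rw [div_lt_iff₀ hp]; linarith)
  rw [div_lt_iff₀ hp] at h3
  rw [← sub_le_iff_le_add, le_div_iff₀ hp] at h4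
  refine ⟨q, x + lam m ^ n * wordLength m p, ?_, by linarith, ?_⟩
  · rw [pow_succ]
    linarith
  · rintro i y ⟨hy, hy1, hy2⟩
    simp only [substWord_iterate_append, patch_append, wordLength_substWord_iterate] at hy
    rcases hy with hy | hy | hy
    · have := mem_patch_bounds hy
      rw [wordLength_substWord_iterate] at this
      linarith [one_le_tileLength m i]
    · exact hy
    · have := mem_patch_bounds hy
      linarith

theorem exists_inner_word {m n : ℕ} {v : List (Fin 2)} {x r : ℝ} (hr : lam m ^ (n + 1) ≤ r)
    (hx : x ≤ -r) (hv : r < x + lam m ^ n * wordLength m v) : ∃ q y,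
      2 * r ≤ lam m ^ n * wordLength m q + 2 * lam m ^ (n + 1) ∧
      lam m ^ n * wordLength m q ≤ 2 * r ∧
      ∀ i, patch m ((substWord m)^[n] q) y i ⊆ cutTyped r (patch m ((substWord m)^[n] v) x) i := by
  have hp : 0 < lam m ^ n := pow_pos (lam_pos m) n
  have hp1 : 0 < lam m ^ (n + 1) := pow_pos (lam_pos m) _
  obtain ⟨p, w, rfl, h1, h2⟩ := exists_split_gt m v (y := (-r - x) / lam m ^ n)
    (div_nonneg (by linarith) hp.le) (by rw [div_lt_iff₀ hp]; linarith)
  rw [div_lt_iff₀ hp] at h1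
  rw [← sub_le_iff_le_add, le_div_iff₀ hp] at h2
  rw [pow_succ] at *
  rw [wordLength_append] at hv
  obtain ⟨q, s, rfl, h3, h4⟩ := exists_split_le m w
    (y := (r - x - lam m ^ n * wordLength m p) / lam m ^ n)
    (div_nonneg (by linarith) hp.le) (by rw [div_le_iff₀ hp]; linarith)
  rw [le_div_iff₀ hp] at h3
  rw [div_le_iff₀ hp] at h4
  refine ⟨q, x + lam m ^ n * wordLength m p, by linarith, by linarith, ?_⟩
  intro i y hy
  have := mem_patch_bounds hy
  rw [wordLength_substWord_iterate] at this
  refine ⟨?_, by linarith, by linarith [one_le_tileLength m i]⟩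
  simp only [substWord_iterate_append, patch_append, wordLength_substWord_iterate]
  exact Or.inr (Or.inl hy)

/-- A translation invariant monotone functional that is additive on patches up to a bounded error
has a uniform density on long windows of inflated words. -/
theorem window_estimate {m : ℕ} (hm : 1 ≤ m) {F : TypedSet → ℝ} {C η : ℝ}
    (hmono : ∀ A B : TypedSet, (∀ i, A i ⊆ B i) → (∀ i, (B i).Finite) → F A ≤ F B)
    (htrans : ∀ (t : ℝ) (A : TypedSet), F (translate t A) = F A)
    (hadd : ∀ u v, |F (patch m (u ++ v) 0) - F (patch m u 0) - F (patch m v 0)| ≤ C)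
    (hη : Tendsto (fun n => F (patch m ((substWord m)^[n] [0]) 0) / lam m ^ (n + 1)) atTop (𝓝 η))
    {δ : ℝ} (hδ : 0 < δ) : ∃ n : ℕ, ∃ R : ℝ, ∀ r ≥ R, ∀ (v : List (Fin 2)) (x : ℝ), x ≤ -r →
      r < x + lam m ^ n * wordLength m v →
        |F (cutTyped r (patch m ((substWord m)^[n] v) x)) - η * (2 * r)| ≤ δ * r := by
  have hC : 0 ≤ C := (abs_nonneg _).trans (hadd [] [])
  have hF : ∀ u x, F (patch m u x) = F (patch m u 0) := by
    intro u x
    rw [← htrans x (patch m u 0), translate_patch, add_zero]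
  obtain ⟨n, hn⟩ := (eventually_abs_sub_le (f := fun u => F (patch m u 0)) hm hadd hη
    (show 0 < δ / 4 by positivity)).exists
  have hp : 0 < lam m ^ n := pow_pos (lam_pos m) n
  have hp1 : 0 < lam m ^ (n + 1) := pow_pos (lam_pos m) _
  -- The first bound makes room for an inner word; the second lets `δ / 2 * r` absorb all boundary
  -- terms, now that `n` is fixed.
  refine ⟨n, max (lam m ^ (n + 1))
    ((δ / 4 * (2 * lam m ^ (n + 1)) + C + |η| * (2 * lam m ^ (n + 1))) / (δ / 2)), ?_⟩
  intro r hr v x hx hv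
  have hr1 := (le_max_left _ _).trans hr
  have hr2 := (le_max_right _ _).trans hr
  rw [div_le_iff₀ (by positivity)] at hr2
  have hword : ∀ q, lam m ^ n * wordLength m q ≤ 2 * r + 2 * lam m ^ (n + 1) →
      2 * r ≤ lam m ^ n * wordLength m q + 2 * lam m ^ (n + 1) →
      |F (patch m ((substWord m)^[n] q) 0) - η * (2 * r)| ≤ δ * r := by
    intro q h1 h2
    have h3 := hn q
    have h4 : |η * (lam m ^ n * wordLength m q) - η * (2 * r)| ≤ |η| * (2 * lam m ^ (n + 1)) := by
      rw [← mul_sub, abs_mul]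
      exact mul_le_mul_of_nonneg_left (abs_le.2 ⟨by linarith, by linarith⟩) (abs_nonneg _)
    have h5 : δ / 4 * (lam m ^ n * wordLength m q) ≤ δ / 4 * (2 * r + 2 * lam m ^ (n + 1)) :=
      mul_le_mul_of_nonneg_left h1 (by positivity)
    refine (abs_sub_le _ (η * (lam m ^ n * wordLength m q)) _).trans ?_
    linarith
  obtain ⟨q, y, h1, h2, h3⟩ := exists_outer_word (by linarith) hx hv
  obtain ⟨q', y', h1', h2', h3'⟩ := exists_inner_word hr1 hx hv
  have hu := hword q h1 (by linarith)
  have hl := hword q' (by linarith) h1'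
  have hu' := hmono _ _ h3 fun i => patch_finite m _ _ i
  have hl' := hmono _ _ h3' fun i => (patch_finite m _ _ i).subset Set.inter_subset_left
  rw [hF] at hu' hl'
  rw [abs_le] at *
  constructor <;> linarith

end Windows

/-! ### The fixed point and the local structure of the hull. -/

section FixedWord

theorem substWord_sq_zero_prefix (m : ℕ) : [0] <+: (substWord m)^[2] [0] := by
  refine ⟨((substWord m)^[2] [0]).tail, ?_⟩
  simp [substWord, substLetter]

theorem substWord_sq_zero_suffix {m : ℕ} (hm : 1 ≤ m) :
    ∃ u, u ≠ [] ∧ (substWord m)^[2] [0] = u ++ [0] := by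
  obtain ⟨k, rfl⟩ := Nat.exists_eq_add_of_le' hm
  refine ⟨substLetter (k + 1) 0 ++ substWord (k + 1) (List.replicate k 1), ?_, ?_⟩
  · simp [substLetter]
  · have h : (substWord (k + 1))^[2] [0] =
        substWord (k + 1) (0 :: (List.replicate k 1 ++ [1])) := by
      rw [← List.replicate_succ']
      simp [substWord, substLetter]
    rw [h, substWord_cons, substWord_append, List.append_assoc]
    simp [substWord, substLetter]

theorem substWord_iterate_prefix (m : ℕ) {M N : ℕ} (h : M ≤ N) :
    (substWord m)^[2 * M] [0] <+: (substWord m)^[2 * N] [0] := by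
  induction N, h using Nat.le_induction with
  | base => exact List.prefix_rfl
  | succ N _ ih =>
    obtain ⟨t, ht⟩ := substWord_sq_zero_prefix m
    refine ih.trans ⟨(substWord m)^[2 * N] t, ?_⟩
    rw [← substWord_iterate_append, ht, ← Function.iterate_add_apply]
    rfl

theorem substWord_iterate_suffix {m : ℕ} (hm : 1 ≤ m) {M N : ℕ} (h : M ≤ N) :
    (substWord m)^[2 * M] [0] <:+ (substWord m)^[2 * N] [0] := by
  induction N, h using Nat.le_induction with
  | base => exact List.suffix_rfl
  | succ N _ ih =>
    obtain ⟨t, -, ht⟩ := substWord_sq_zero_suffix hm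
    refine ih.trans ⟨(substWord m)^[2 * N] t, ?_⟩
    rw [← substWord_iterate_append, ← ht, ← Function.iterate_add_apply]
    rfl

theorem lt_length_substWord_iterate {m : ℕ} (hm : 1 ≤ m) (n : ℕ) :
    n < ((substWord m)^[2 * n] [0]).length := by
  induction n with
  | zero => simp
  | succ n ih =>
    obtain ⟨t, h0, ht⟩ := substWord_sq_zero_suffix hm
    have hlen : 0 < ((substWord m)^[2 * n] t).length := by
      by_contra hlen
      have h1 : (substWord m)^[2 * n] t = [] := List.length_eq_zero_iff.1 (by omega)
      have h2 := wordLength_substWord_iterate m (2 * n) t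
      have h3 : (0 : ℝ) < t.length := by exact_mod_cast List.length_pos_iff.2 h0
      rw [h1, wordLength_nil] at h2
      have := mul_pos (pow_pos (lam_pos m) (2 * n)) (h3.trans_le (length_le_wordLength m t))
      linarith
    have heq : (substWord m)^[2 * (n + 1)] [0] =
        (substWord m)^[2 * n] t ++ (substWord m)^[2 * n] [0] := by
      rw [← substWord_iterate_append, ← ht, ← Function.iterate_add_apply]
      rfl
    rw [heq, List.length_append]
    omega

theorem getD_eq_of_prefix {α : Type*} {u v : List α} (h : u <+: v) {n : ℕ} (hn : n < u.length)
    (d : α) : u.getD n d = v.getD n d := by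
  obtain ⟨t, rfl⟩ := h
  rw [List.getD_append _ _ _ _ hn]

theorem fixedWord_natCast {m : ℕ} (hm : 1 ≤ m) {n N : ℕ}
    (hn : n < ((substWord m)^[2 * N] [0]).length) :
    fixedWord m n = ((substWord m)^[2 * N] [0]).getD n 0 := by
  have hn' := lt_length_substWord_iterate hm (n + 1)
  change ((substWord m)^[2 * (n + 1)] [0]).getD n 0 = _
  rcases le_total (n + 1) N with h | h
  · exact getD_eq_of_prefix (substWord_iterate_prefix m h) (by omega) 0
  · exact (getD_eq_of_prefix (substWord_iterate_prefix m h) hn 0).symm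

theorem fixedWord_negSucc {m : ℕ} (hm : 1 ≤ m) {n N : ℕ}
    (hn : n < ((substWord m)^[2 * N] [0]).length) :
    fixedWord m (Int.negSucc n) = ((substWord m)^[2 * N] [0]).reverse.getD n 0 := by
  have hn' := lt_length_substWord_iterate hm (n + 1)
  change ((substWord m)^[2 * (n + 1)] [0]).reverse.getD n 0 = _
  rcases le_total (n + 1) N with h | h
  · exact getD_eq_of_prefix (List.reverse_prefix.2 (substWord_iterate_suffix hm h))
      (by rw [List.length_reverse]; omega) 0
  · exact (getD_eq_of_prefix (List.reverse_prefix.2 (substWord_iterate_suffix hm h))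
      (by rwa [List.length_reverse]) 0).symm

theorem tilePos_succ (m : ℕ) (k : ℤ) :
    tilePos m (k + 1) = tilePos m k + tileLength m (fixedWord m k) := by
  rcases k with n | n
  · change tilePos m (Int.ofNat (n + 1)) = _
    simp only [tilePos, Finset.sum_range_succ]
  · rcases n with - | n
    · change tilePos m (Int.ofNat 0) = _
      simp [tilePos]
    · have h : Int.negSucc (n + 1) + 1 = Int.negSucc n := by omega
      rw [h]
      simp only [tilePos, Finset.sum_range_succ _ (n + 1)]
      ring

theorem tilePos_strictMono (m : ℕ) : StrictMono (tilePos m) := by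
  refine strictMono_int_of_lt_succ fun k => ?_
  rw [tilePos_succ]
  linarith [one_le_tileLength m (fixedWord m k)]

theorem patch_map_range (m k : ℕ) (a : ℤ) (i : Fin 2) :
    patch m ((List.range k).map fun l : ℕ => fixedWord m (a + l)) (tilePos m a) i =
      {y | ∃ l < k, fixedWord m (a + l) = i ∧ tilePos m (a + l) = y} := by
  induction k generalizing a with
  | zero => simp [patch]
  | succ k ih =>
    have h : (List.range (k + 1)).map (fun l : ℕ => fixedWord m (a + l)) =
        fixedWord m a :: (List.range k).map fun l : ℕ => fixedWord m (a + 1 + l) := by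
      rw [List.range_succ_eq_map]
      simp [Function.comp_def, add_assoc, add_comm (1 : ℤ)]
    rw [h]
    simp only [patch, ← tilePos_succ, ih]
    ext y
    constructor
    · rintro (⟨rfl, rfl⟩ | ⟨l, hl, rfl, rfl⟩)
      · exact ⟨0, by omega, by simp, by simp⟩
      · exact ⟨l + 1, by omega, by push_cast; ring_nf, by push_cast; ring_nf⟩
    · rintro ⟨l, hl, rfl, rfl⟩
      rcases l with - | l
      · exact Or.inl ⟨by simp, by simp⟩
      · exact Or.inr ⟨l, by omega, by push_cast; ring_nf, by push_cast; ring_nf⟩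

theorem wordLength_map_range (m k : ℕ) (a : ℤ) :
    wordLength m ((List.range k).map fun l : ℕ => fixedWord m (a + l)) =
      tilePos m (a + k) - tilePos m a := by
  induction k with
  | zero => simp
  | succ k ih =>
    rw [List.range_succ, List.map_append, wordLength_append, ih]
    push_cast
    rw [← add_assoc, tilePos_succ]
    simp
    ring

theorem map_range_fixedWord {m : ℕ} (hm : 1 ≤ m) (N : ℕ) :
    ((List.range ((substWord m)^[2 * N] [0]).length).map fun l : ℕ => fixedWord m (0 + l)) =
      (substWord m)^[2 * N] [0] := by
  refine List.ext_getElem (by simp) fun l h1 h2 => ?_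
  rw [List.getElem_map, List.getElem_range, zero_add, fixedWord_natCast hm h2,
    List.getD_eq_getElem _ _ h2]

theorem map_range_fixedWord_neg {m : ℕ} (hm : 1 ≤ m) (N : ℕ) :
    ((List.range ((substWord m)^[2 * N] [0]).length).map
      fun l : ℕ => fixedWord m (-(((substWord m)^[2 * N] [0]).length : ℤ) + l)) =
      (substWord m)^[2 * N] [0] := by
  refine List.ext_getElem (by simp) fun l h1 h2 => ?_
  have h3 : ((substWord m)^[2 * N] [0]).length - 1 - l < ((substWord m)^[2 * N] [0]).length := by
    omega
  have h4 : -(((substWord m)^[2 * N] [0]).length : ℤ) + l =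
      Int.negSucc (((substWord m)^[2 * N] [0]).length - 1 - l) := by omega
  rw [List.getElem_map, List.getElem_range, h4, fixedWord_negSucc hm h3,
    List.getD_eq_getElem _ _ (by rwa [List.length_reverse]), List.getElem_reverse]
  congr 1
  omega

/-- Around the origin the tiling is the patch of ϱ^{2N}(0)|ϱ^{2N}(0), which is ϱⁿ applied to
ϱ^{2N-n}(00); odd `n` is therefore allowed. -/
theorem fixedTiling_window {m : ℕ} (hm : 1 ≤ m) (R : ℝ) (n : ℕ) :
    ∃ (v : List (Fin 2)) (x : ℝ), x ≤ -R ∧ R < x + lam m ^ n * wordLength m v ∧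
      ∀ y, |y| ≤ R → ∀ i, y ∈ fixedTiling m i ↔ y ∈ patch m ((substWord m)^[n] v) x i := by
  obtain ⟨N₀, hN₀⟩ := pow_unbounded_of_one_lt R (one_lt_lam hm)
  set N := N₀ + n with hN
  have hR : R < lam m ^ (2 * N + 1) :=
    hN₀.trans_le (pow_le_pow_right₀ (one_le_lam m) (by omega))
  set u := (substWord m)^[2 * N] [0] with hu
  set K := u.length with hK
  have hlen : wordLength m u = lam m ^ (2 * N + 1) := by
    rw [hu, wordLength_substWord_iterate]
    simp [pow_succ]
  have h0 : tilePos m 0 = 0 := by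
    change tilePos m (Int.ofNat 0) = 0
    simp [tilePos]
  have hposK : tilePos m K = lam m ^ (2 * N + 1) := by
    have h := wordLength_map_range m K 0
    rw [map_range_fixedWord hm, ← hu, hlen, h0] at h
    simpa using h.symm
  have hnegK : tilePos m (-K) = -lam m ^ (2 * N + 1) := by
    have h := wordLength_map_range m K (-K)
    rw [map_range_fixedWord_neg hm, ← hu, hlen, neg_add_cancel, h0] at h
    linarith
  have hword : (substWord m)^[n] ((substWord m)^[2 * N - n] [0, 0]) = u ++ u := by
    rw [← Function.iterate_add_apply, Nat.add_sub_cancel' (by omega), hu,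
      ← substWord_iterate_append]
    rfl
  refine ⟨(substWord m)^[2 * N - n] [0, 0], -lam m ^ (2 * N + 1), by linarith, ?_, ?_⟩
  · rw [← wordLength_substWord_iterate, hword, wordLength_append, hlen]
    linarith
  · intro y hy i
    rw [abs_le] at hy
    have hP1 : patch m u (-lam m ^ (2 * N + 1)) i =
        {y | ∃ l < K, fixedWord m (-K + l) = i ∧ tilePos m (-K + l) = y} := by
      rw [← hnegK, ← patch_map_range, map_range_fixedWord_neg hm]
    have hP2 : patch m u 0 i =
        {y | ∃ l < K, fixedWord m (0 + l) = i ∧ tilePos m (0 + l) = y} := by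
      rw [← patch_map_range, map_range_fixedWord hm, h0]
    rw [hword, patch_append, hlen, neg_add_cancel, hP1, hP2]
    constructor
    · rintro ⟨k, rfl, rfl⟩
      have hk1 : -(K : ℤ) ≤ k := (tilePos_strictMono m).le_iff_le.1 (by linarith)
      have hk2 : k < (K : ℤ) := (tilePos_strictMono m).lt_iff_lt.1 (by linarith)
      rcases lt_or_ge k 0 with hk | hk
      · have h : -(K : ℤ) + (k + K).toNat = k := by omega
        exact Or.inl ⟨(k + K).toNat, by omega, by rw [h], by rw [h]⟩
      · have h : 0 + (k.toNat : ℤ) = k := by omega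
        exact Or.inr ⟨k.toNat, by omega, by rw [h], by rw [h]⟩
    · rintro (⟨l, -, rfl, rfl⟩ | ⟨l, -, rfl, rfl⟩)
      · exact ⟨_, rfl, rfl⟩
      · exact ⟨_, rfl, rfl⟩

theorem hull_window {m : ℕ} (hm : 1 ≤ m) {L : TypedSet} (hL : L ∈ hull m) {r : ℝ} (hr : 0 ≤ r)
    (n : ℕ) : ∃ (v : List (Fin 2)) (x : ℝ), x ≤ -r ∧ r < x + lam m ^ n * wordLength m v ∧
      cutTyped r L = cutTyped r (patch m ((substWord m)^[n] v) x) := by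
  have hr1 : 0 < r + 1 := by linarith
  -- The agreement reaches out to r + 1, and the shift `s` is at most 1, so all of [-r, r] is
  -- covered.
  obtain ⟨t, s, hs, hw⟩ := hL (1 / (r + 1)) (by positivity)
  rw [one_div_one_div] at hw
  have hs1 : |s| ≤ 1 := hs.trans ((div_le_one hr1).2 (by linarith))
  obtain ⟨v, x, h1, h2, h3⟩ := fixedTiling_window hm (r + |t - s|) n
  have h4 := neg_abs_le (t - s)
  have h5 := le_abs_self (t - s)
  refine ⟨v, t - s + x, by linarith, by linarith, ?_⟩
  funext i
  ext y
  simp only [cutTyped, cut, Set.mem_inter_iff, Set.mem_Icc]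
  refine and_congr_left fun hy => ?_
  rw [abs_le] at hs1
  have h6 : s + y ∈ Set.Icc (-(r + 1)) (r + 1) := ⟨by linarith, by linarith⟩
  have h7 : y ∈ L i ↔ s + y ∈ translate s L i := by simp [translate]
  have h8 : s + y ∈ translate t (fixedTiling m) i ↔ y - (t - s) ∈ fixedTiling m i := by
    simp only [translate, Set.mem_image]
    constructor
    · rintro ⟨z, hz, h⟩
      rwa [show y - (t - s) = z by linarith]
    · exact fun h => ⟨_, h, by ring⟩
  have h9 : s + y ∈ translate s L i ↔ s + y ∈ translate t (fixedTiling m) i := by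
    have := Set.ext_iff.1 (hw i) (s + y)
    simpa only [Set.mem_inter_iff, h6, and_true] using this
  have h10 : |y - (t - s)| ≤ r + |t - s| :=
    (abs_sub _ _).trans (by linarith [abs_le.2 hy])
  rw [h7, h9, h8, h3 _ h10, ← translate_patch]
  simp only [translate, Set.mem_image]
  constructor
  · exact fun h => ⟨_, h, by ring⟩
  · rintro ⟨z, hz, h⟩
    rwa [show y - (t - s) = z by linarith]

end FixedWord

/-! ### Counting pairs and tiles in patches. -/

section Counting

theorem ncard_le_of_separated {S : Set ℝ} {a l : ℝ} (hl : 0 ≤ l) (hS : S ⊆ Set.Icc a (a + l))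
    (hsep : ∀ x ∈ S, ∀ y ∈ S, x ≠ y → 1 ≤ |x - y|) : (S.ncard : ℝ) ≤ l + 1 := by
  have h1 : S.ncard ≤ (Finset.range (⌊l⌋₊ + 1) : Set ℕ).ncard := by
    refine Set.ncard_le_ncard_of_injOn (fun x => ⌊x - a⌋₊) ?_ ?_ (Finset.finite_toSet _)
    · intro x hx
      have hxl : x - a ≤ l := by linarith [(hS hx).2]
      simpa [Nat.lt_succ_iff] using Nat.floor_le_floor hxl
    · intro x hx y hy hxy
      by_contra hne
      have hx1 := Nat.floor_le (show 0 ≤ x - a by linarith [(hS hx).1])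
      have hy1 := Nat.floor_le (show 0 ≤ y - a by linarith [(hS hy).1])
      have hx2 := Nat.lt_floor_add_one (x - a)
      have hy2 := Nat.lt_floor_add_one (y - a)
      simp only at hxy
      rw [hxy] at hx1 hx2
      have h := hsep x hx y hy hne
      have h' : |x - y| < 1 := abs_lt.2 ⟨by linarith, by linarith⟩
      linarith
  rw [Set.ncard_coe_finset, Finset.card_range] at h1
  have h2 : (S.ncard : ℝ) ≤ (⌊l⌋₊ + 1 : ℕ) := by exact_mod_cast h1
  push_cast at h2
  linarith [Nat.floor_le hl]

theorem ncard_finset_biUnion {ι α : Type*} (t : Finset ι) (S : ι → Set α)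
    (hS : ∀ a ∈ t, (S a).Finite) (h : (t : Set ι).PairwiseDisjoint S) :
    (⋃ a ∈ t, S a).ncard = ∑ a ∈ t, (S a).ncard := by
  rw [← finsum_mem_coe_finset]
  exact Set.Finite.ncard_biUnion t.finite_toSet hS h

/-- The left partners of the pairs of points of types `i` and `j` at distance `z`. -/
def pairs (L : TypedSet) (i j : Fin 2) (z : ℝ) : Set ℝ := {x | x ∈ L i ∧ x + z ∈ L j}

/-- The number of pairs of points of types `i` and `j` at distance `z`. -/
noncomputable def pairCount (i j : Fin 2) (z : ℝ) (L : TypedSet) : ℝ := (pairs L i j z).ncard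

/-- The number of points of a typed point set. -/
noncomputable def tileCount (L : TypedSet) : ℝ := (⋃ k, L k).ncard

theorem pairRatio_eq (L : TypedSet) (i j : Fin 2) (z r : ℝ) :
    pairRatio L i j z r = pairCount i j z (cutTyped r L) / tileCount (cutTyped r L) := by
  have h1 : cut r (L i) ∩ (fun x => x - z) '' cut r (L j) = pairs (cutTyped r L) i j z := by
    ext x
    simp only [pairs, cutTyped, Set.mem_inter_iff, Set.mem_image, Set.mem_ofPred_eq]
    refine and_congr_right fun _ => ⟨?_, fun h => ⟨_, h, by ring⟩⟩
    rintro ⟨y, hy, rfl⟩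
    simpa using hy
  have h2 : cut r (⋃ k, L k) = ⋃ k, cutTyped r L k := Set.iUnion_inter _ _
  rw [pairRatio, h1, h2, pairCount, tileCount]

theorem pairs_finite {L : TypedSet} {i : Fin 2} (h : (L i).Finite) (j : Fin 2) (z : ℝ) :
    (pairs L i j z).Finite := h.subset fun _ hx => hx.1

theorem pairCount_nonneg (i j : Fin 2) (z : ℝ) (L : TypedSet) : 0 ≤ pairCount i j z L :=
  Nat.cast_nonneg _

theorem pairCount_mono (i j : Fin 2) (z : ℝ) (A B : TypedSet) (h : ∀ i, A i ⊆ B i)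
    (hB : ∀ i, (B i).Finite) : pairCount i j z A ≤ pairCount i j z B :=
  Nat.cast_le.2 (Set.ncard_le_ncard (fun _ hx => ⟨h i hx.1, h j hx.2⟩) (pairs_finite (hB i) j z))

theorem mem_translate {t x : ℝ} {L : TypedSet} {i : Fin 2} :
    t + x ∈ translate t L i ↔ x ∈ L i := by simp [translate]

theorem pairCount_translate (i j : Fin 2) (z t : ℝ) (L : TypedSet) :
    pairCount i j z (translate t L) = pairCount i j z L := by
  have h : pairs (translate t L) i j z = (fun x => t + x) '' pairs L i j z := by
    ext y
    constructor
    · rintro ⟨⟨x, hx, rfl⟩, hy⟩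
      simp only [add_assoc, mem_translate] at hy
      exact ⟨x, ⟨hx, hy⟩, rfl⟩
    · rintro ⟨x, ⟨h1, h2⟩, rfl⟩
      refine ⟨mem_translate.2 h1, ?_⟩
      simp only [add_assoc, mem_translate]
      exact h2
  rw [pairCount, pairCount, h, Set.ncard_image_of_injective _ (add_right_injective t)]

theorem pairCount_append (m : ℕ) (i j : Fin 2) (z : ℝ) (u v : List (Fin 2)) :
    |pairCount i j z (patch m (u ++ v) 0) - pairCount i j z (patch m u 0) -
      pairCount i j z (patch m v 0)| ≤ 2 * |z| + 1 := by
  have hv : pairCount i j z (patch m v 0) = pairCount i j z (patch m v (wordLength m u)) := by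
    rw [← pairCount_translate i j z (wordLength m u) (patch m v 0), translate_patch, add_zero]
  set P := pairs (patch m (u ++ v) 0) i j z with hP
  set U := pairs (patch m u 0) i j z with hU
  set V := pairs (patch m v (wordLength m u)) i j z with hV
  have hPf : P.Finite := pairs_finite (patch_finite m _ _ i) j z
  have hUf : U.Finite := pairs_finite (patch_finite m _ _ i) j z
  have hVf : V.Finite := pairs_finite (patch_finite m _ _ i) j z
  have hUV : U ∪ V ⊆ P := by
    rintro x (⟨h1, h2⟩ | ⟨h1, h2⟩)
    · exact ⟨by rw [patch_append]; exact Or.inl h1, by rw [patch_append]; exact Or.inl h2⟩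
    · refine ⟨?_, ?_⟩ <;> rw [patch_append, zero_add]
      · exact Or.inr h1
      · exact Or.inr h2
  have hdisj : Disjoint U V := by
    rw [Set.disjoint_left]
    intro x h1 h2
    have h3 := mem_patch_bounds h1.1
    have h4 := mem_patch_bounds h2.1
    linarith [one_le_tileLength m i]
  have hcross : ((P \ (U ∪ V)).ncard : ℝ) ≤ 2 * |z| + 1 := by
    -- A pair using both words has its point `x` within |z| of the seam.
    refine ncard_le_of_separated (a := wordLength m u - |z|) (by positivity) ?_ ?_
    · rintro x ⟨⟨h1, h2⟩, h3⟩
      rw [patch_append, zero_add] at h1 h2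
      have hz1 := le_abs_self z
      have hz2 := neg_abs_le z
      rcases h1 with h1 | h1 <;> rcases h2 with h2 | h2
      · exact (h3 (Or.inl ⟨h1, h2⟩)).elim
      · have h4 := mem_patch_bounds h1
        have h5 := mem_patch_bounds h2
        have h6 := one_le_tileLength m i
        constructor <;> linarith
      · have h4 := mem_patch_bounds h1
        have h5 := mem_patch_bounds h2
        have h6 := one_le_tileLength m j
        constructor <;> linarith
      · exact (h3 (Or.inr ⟨h1, h2⟩)).elim
    · intro x hx y hy hne
      have h6 := one_le_tileLength m i
      rcases patch_separated hx.1.1 hy.1.1 with h | h | h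
      · exact (hne h.1).elim
      · rw [abs_sub_comm]
        exact le_abs.2 (Or.inl (by linarith))
      · exact le_abs.2 (Or.inl (by linarith))
  have h1 := Set.ncard_sdiff_add_ncard_of_subset hUV hPf
  rw [Set.ncard_union_eq hdisj hUf hVf] at h1
  have h2 : ((P \ (U ∪ V)).ncard : ℝ) + (U.ncard + V.ncard) = P.ncard := by exact_mod_cast h1
  rw [hv]
  change |(P.ncard : ℝ) - U.ncard - V.ncard| ≤ _
  rw [← h2, show ∀ a b c : ℝ, a + (b + c) - b - c = a by intros; ring, abs_of_nonneg (by positivity)]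
  exact hcross

theorem pairCount_substWord (m : ℕ) (i j : Fin 2) (z : ℝ) (u : List (Fin 2)) :
    pairCount i j z (patch m (substWord m u) 0) = ∑ k : Fin 2, ∑ l : Fin 2,
      ∑ r ∈ T m i k, ∑ s ∈ T m j l, pairCount k l ((z + r - s) / lam m) (patch m u 0) := by
  have hl := (lam_pos m).ne'
  -- An index records the two supertile types and the offsets of both partners; its pairs are an
  -- affine image of pairs in `u`.
  set t : Finset (Σ _ : Fin 2 × Fin 2, ℝ × ℝ) :=
    Finset.univ.sigma fun q => T m i q.1 ×ˢ T m j q.2 with ht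
  set S : (Σ _ : Fin 2 × Fin 2, ℝ × ℝ) → Set ℝ := fun a => (fun x => lam m * x + a.2.1) ''
    pairs (patch m u 0) a.1.1 a.1.2 ((z + a.2.1 - a.2.2) / lam m) with hS
  have hinj : ∀ r : ℝ, Function.Injective fun x => lam m * x + r := fun r x y h => by
    simpa [hl] using h
  have hpatch : ∀ a, patch m (substWord m u) 0 a =
      {y | ∃ k, ∃ r ∈ T m a k, ∃ x' ∈ patch m u 0 k, y = lam m * x' + r} := fun a => by
    simpa using patch_substWord m u 0 a
  have hpairs : pairs (patch m (substWord m u) 0) i j z = ⋃ a ∈ t, S a := by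
    ext x
    simp only [Set.mem_iUnion, pairs, hpatch, Set.mem_ofPred_eq]
    constructor
    · rintro ⟨⟨k, r, hr, y, hy, rfl⟩, l, s, hs, w, hw, h⟩
      refine ⟨⟨(k, l), (r, s)⟩, by simp [ht, hr, hs], y, ⟨hy, ?_⟩, rfl⟩
      have : y + (z + r - s) / lam m = w := by
        field_simp
        linarith
      simpa only [this] using hw
    · rintro ⟨⟨⟨k, l⟩, r, s⟩, ha, y, ⟨h1, h2⟩, rfl⟩
      simp only [ht, Finset.mem_sigma, Finset.mem_univ, Finset.mem_product, true_and] at ha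
      refine ⟨⟨k, r, ha.1, y, h1, rfl⟩, l, s, ha.2, _, h2, ?_⟩
      simp only
      field_simp
      ring
  have hfin : ∀ a ∈ t, (S a).Finite := fun a _ =>
    (pairs_finite (patch_finite m _ _ _) _ _).image _
  have hdisj : (t : Set (Σ _ : Fin 2 × Fin 2, ℝ × ℝ)).PairwiseDisjoint S := by
    rintro ⟨⟨k, l⟩, r, s⟩ ha ⟨⟨k', l'⟩, r', s'⟩ hb hne
    simp only [ht, Finset.mem_coe, Finset.mem_sigma, Finset.mem_univ, Finset.mem_product,
      true_and] at ha hb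
    simp only [Function.onFun, Set.disjoint_left]
    rintro x ⟨y, ⟨h1, h2⟩, rfl⟩ ⟨y', ⟨h1', h2'⟩, h⟩
    simp only at h1 h2 h1' h2' h
    -- The first partner fixes its supertile and offset; the second partner, the same point shifted
    -- by `z`, then fixes the rest of the index.
    obtain ⟨rfl, rfl, rfl⟩ := patch_inflate_injective hb.1 ha.1 h1' h1 h
    obtain ⟨rfl, rfl, -⟩ := patch_inflate_injective hb.2 ha.2 h2' h2
      (by field_simp; ring)
    exact hne rfl
  rw [pairCount, hpairs, ncard_finset_biUnion t S hfin hdisj, ht, Finset.sum_sigma,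
    Fintype.sum_prod_type]
  simp only [Finset.sum_product, hS, Set.ncard_image_of_injective _ (hinj _), pairCount,
    Nat.cast_sum]

theorem tileCount_patch (m : ℕ) (u : List (Fin 2)) (x : ℝ) :
    tileCount (patch m u x) = u.length := by
  induction u generalizing x with
  | nil => simp [tileCount, patch]
  | cons a u ih =>
    have h1 : (⋃ k, patch m (a :: u) x k) = insert x (⋃ k, patch m u (x + tileLength m a) k) := by
      ext y
      simp only [patch, Set.mem_iUnion, Set.mem_union, Set.mem_ofPred_eq, Set.mem_insert_iff]
      constructor
      · rintro ⟨k, ⟨-, h⟩ | h⟩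
        · exact Or.inl h
        · exact Or.inr ⟨k, h⟩
      · rintro (h | ⟨k, h⟩)
        · exact ⟨a, Or.inl ⟨rfl, h⟩⟩
        · exact ⟨k, Or.inr h⟩
    have h2 : x ∉ ⋃ k, patch m u (x + tileLength m a) k := by
      simp only [Set.mem_iUnion, not_exists]
      intro k hk
      linarith [(mem_patch_bounds hk).1, one_le_tileLength m a]
    have h3 := ih (x + tileLength m a)
    rw [tileCount] at h3
    rw [tileCount, h1, Set.ncard_insert_of_notMem h2
      (Set.finite_iUnion fun k => patch_finite m _ _ k), Nat.cast_add, h3]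
    simp

theorem tileCount_mono (A B : TypedSet) (h : ∀ i, A i ⊆ B i) (hB : ∀ i, (B i).Finite) :
    tileCount A ≤ tileCount B :=
  Nat.cast_le.2 (Set.ncard_le_ncard (Set.iUnion_mono h) (Set.finite_iUnion hB))

theorem tileCount_translate (t : ℝ) (L : TypedSet) : tileCount (translate t L) = tileCount L := by
  simp only [tileCount, translate, ← Set.image_iUnion,
    Set.ncard_image_of_injective _ (add_right_injective t)]

end Counting

/-! ### Densities on the hull and their renormalisation. -/

section Densities

theorem tendsto_hull_density {m : ℕ} (hm : 1 ≤ m) {F : TypedSet → ℝ} {C η : ℝ}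
    (hmono : ∀ A B : TypedSet, (∀ i, A i ⊆ B i) → (∀ i, (B i).Finite) → F A ≤ F B)
    (htrans : ∀ (t : ℝ) (A : TypedSet), F (translate t A) = F A)
    (hadd : ∀ u v, |F (patch m (u ++ v) 0) - F (patch m u 0) - F (patch m v 0)| ≤ C)
    (hη : Tendsto (fun n => F (patch m ((substWord m)^[n] [0]) 0) / lam m ^ (n + 1)) atTop (𝓝 η))
    {L : TypedSet} (hL : L ∈ hull m) :
    Tendsto (fun r => F (cutTyped r L) / (2 * r)) atTop (𝓝 η) := by
  rw [Metric.tendsto_nhds]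
  intro ε hε
  obtain ⟨n, R, hR⟩ := window_estimate hm hmono htrans hadd hη hε
  filter_upwards [eventually_ge_atTop R, eventually_gt_atTop 0] with r hr hr0
  obtain ⟨v, x, h1, h2, h3⟩ := hull_window hm hL hr0.le n
  have h4 := hR r hr v x h1 h2
  have h5 : 0 < 2 * r := by linarith
  rw [h3, Real.dist_eq, div_sub' h5.ne', abs_div, abs_of_pos h5, div_lt_iff₀ h5, mul_comm _ η]
  nlinarith

theorem exists_tile_density {m : ℕ} (hm : 1 ≤ m) : ∃ η : ℝ, 0 < η ∧
    ∀ L ∈ hull m, Tendsto (fun r => tileCount (cutTyped r L) / (2 * r)) atTop (𝓝 η) := by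
  have hadd : ∀ u v, |tileCount (patch m (u ++ v) 0) - tileCount (patch m u 0) -
      tileCount (patch m v 0)| ≤ 0 := fun u v => by simp [tileCount_patch]
  obtain ⟨η, hη⟩ := exists_density (f := fun u => tileCount (patch m u 0)) hm hadd
  refine ⟨η, ?_, fun L hL =>
    tendsto_hull_density hm tileCount_mono tileCount_translate hadd hη hL⟩
  -- Tiles have length at most λ, so there is at least one per length λ.
  refine (inv_pos.2 (lam_pos m)).trans_le (ge_of_tendsto' hη fun n => ?_)
  have h := wordLength_le m ((substWord m)^[n] [0])
  have hl := lam_pos m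
  rw [wordLength_substWord_iterate] at h
  simp only [wordLength_cons, wordLength_nil, tileLength_zero, add_zero, ← pow_succ] at h
  rwa [tileCount_patch, le_div_iff₀ (pow_pos hl _), inv_mul_le_iff₀ hl]

theorem exists_pair_density {m : ℕ} (hm : 1 ≤ m) : ∃ η : Fin 2 → Fin 2 → ℝ → ℝ,
    (∀ i j z, 0 ≤ η i j z) ∧
    (∀ L ∈ hull m, ∀ i j z,
      Tendsto (fun r => pairCount i j z (cutTyped r L) / (2 * r)) atTop (𝓝 (η i j z))) ∧
    ∀ i j z, η i j z = (lam m)⁻¹ * ∑ k : Fin 2, ∑ l : Fin 2, ∑ r ∈ T m i k, ∑ s ∈ T m j l,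
      η k l ((z + r - s) / lam m) := by
  choose η hη using fun (i j : Fin 2) (z : ℝ) =>
    exists_density (f := fun u => pairCount i j z (patch m u 0)) hm (pairCount_append m i j z)
  refine ⟨η, fun i j z => ge_of_tendsto' (hη i j z) fun n =>
    div_nonneg (pairCount_nonneg _ _ _ _) (pow_nonneg (lam_pos m).le _), ?_, ?_⟩
  · exact fun L hL i j z => tendsto_hull_density hm (pairCount_mono i j z)
      (pairCount_translate i j z) (pairCount_append m i j z) (hη i j z) hL
  · intro i j z
    -- Level n + 1 is counted through level n; the extra power of λ in the normalisation becomes the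
    -- prefactor.
    refine tendsto_nhds_unique ((tendsto_add_atTop_iff_nat 1).2 (hη i j z)) ?_
    have h : Tendsto (fun n => (lam m)⁻¹ * ∑ k : Fin 2, ∑ l : Fin 2, ∑ r ∈ T m i k, ∑ s ∈ T m j l,
        pairCount k l ((z + r - s) / lam m) (patch m ((substWord m)^[n] [0]) 0) / lam m ^ (n + 1))
        atTop (𝓝 ((lam m)⁻¹ * ∑ k : Fin 2, ∑ l : Fin 2, ∑ r ∈ T m i k, ∑ s ∈ T m j l,
          η k l ((z + r - s) / lam m))) :=
      (tendsto_finsetSum _ fun k _ => tendsto_finsetSum _ fun l _ => tendsto_finsetSum _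
        fun r _ => tendsto_finsetSum _ fun s _ => hη k l _).const_mul _
    refine h.congr fun n => ?_
    simp only [← Finset.sum_div]
    rw [Function.iterate_succ_apply', pairCount_substWord, pow_succ _ (n + 1), mul_comm,
      ← div_eq_mul_inv, div_div]

theorem diffSet_subset {m : ℕ} (hm : 1 ≤ m) {L : TypedSet} (hL : L ∈ hull m) (i j : Fin 2) :
    diffSet L i j ⊆ signedLengths m := by
  rintro z ⟨x, hx, y, hy, rfl⟩
  obtain ⟨v, t, -, -, h⟩ :=
    hull_window hm hL (r := max |x| |y|) ((abs_nonneg x).trans (le_max_left _ _)) 0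
  have hx' : x ∈ cutTyped (max |x| |y|) L i := ⟨hx, abs_le.1 (le_max_left _ _)⟩
  have hy' : y ∈ cutTyped (max |x| |y|) L j := ⟨hy, abs_le.1 (le_max_right _ _)⟩
  rw [h] at hx' hy'
  exact sub_mem_signedLengths hx'.1 hy'.1

end Densities

/-! ### Pair correlation measures and the convolution identity. -/

section Measures

theorem measure_ext_of_countable {μ ν : Measure ℝ} {C : Set ℝ} (hC : C.Countable)
    (hμ : μ Cᶜ = 0) (hν : ν Cᶜ = 0) (h : ∀ x, μ {x} = ν {x}) : μ = ν := by
  ext s -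
  have hs : (s ∩ C).Countable := hC.mono Set.inter_subset_right
  have key : ∀ ρ : Measure ℝ, ρ (s ∩ C) = ∑' x : ↥(s ∩ C), ρ {(x : ℝ)} := by
    intro ρ
    conv_lhs => rw [← Set.biUnion_of_singleton (s ∩ C)]
    exact measure_biUnion hs (fun x _ y _ hxy => Set.disjoint_singleton.2 hxy)
      fun x _ => measurableSet_singleton x
  rw [← measure_inter_conull (s := s) hμ, ← measure_inter_conull (s := s) hν, key, key]
  simp only [h]

instance sFinite_deltaT (m : ℕ) (i j : Fin 2) : SFinite (deltaT m i j) := by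
  unfold deltaT
  induction T m i j using Finset.induction_on with
  | empty => rw [Finset.sum_empty]; infer_instance
  | insert a t ha ih => rw [Finset.sum_insert ha]; infer_instance

theorem tilde_deltaT (m : ℕ) (i j : Fin 2) :
    tilde (deltaT m) i j = ∑ r ∈ T m i j, Measure.dirac (-r) := by
  ext s hs
  rw [tilde, deltaT, Measure.map_apply measurable_neg hs, Measure.finsetSum_apply,
    Measure.finsetSum_apply]
  refine Finset.sum_congr rfl fun r _ => ?_
  rw [Measure.dirac_apply' _ hs, Measure.dirac_apply' _ (measurable_neg hs)]
  rfl

theorem kroneckerConv_conv_apply (m : ℕ) (p q : Fin 2 × Fin 2) (μ : Measure ℝ) [SFinite μ]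
    {s : Set ℝ} (hs : MeasurableSet s) :
    ((kroneckerConv (tilde (deltaT m)) (deltaT m) p q).conv (μ.map fun x => lam m * x)) s =
      ∑ r ∈ T m p.1 q.1, ∑ t ∈ T m p.2 q.2, μ ((fun y => -r + t + lam m * y) ⁻¹' s) := by
  have hf : Measurable (s.indicator (1 : ℝ → ENNReal)) := measurable_one.indicator hs
  have hg : Measurable fun x => ∫⁻ y, s.indicator (1 : ℝ → ENNReal) (x + y)
      ∂(μ.map fun x => lam m * x) :=
    (hf.comp measurable_add).lintegral_prod_right'
  rw [← lintegral_indicator_one hs, Measure.lintegral_conv hf, kroneckerConv,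
    Measure.lintegral_conv hg, tilde_deltaT, lintegral_finsetSum_measure]
  refine Finset.sum_congr rfl fun r _ => ?_
  rw [lintegral_dirac, deltaT, lintegral_finsetSum_measure]
  refine Finset.sum_congr rfl fun t _ => ?_
  have hh : Measurable fun y => s.indicator (1 : ℝ → ENNReal) (-r + t + y) :=
    hf.comp (measurable_const_add _)
  rw [lintegral_dirac, lintegral_map hh (measurable_const_mul _),
    ← lintegral_indicator_one ((by fun_prop : Measurable fun y => -r + t + lam m * y) hs)]
  rfl

variable {ν : Fin 2 → Fin 2 → ℝ → ℝ} {L : TypedSet}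

theorem sFinite_pairMeasure (h : ∀ i j, (diffSet L i j).Countable) (p : Fin 2 × Fin 2) :
    SFinite (pairMeasure ν L p) := by
  have := (h p.1 p.2).to_subtype
  unfold pairMeasure
  infer_instance

theorem pairMeasure_singleton (hν : ∀ i j z, z ∉ diffSet L i j → ν i j z = 0)
    (p : Fin 2 × Fin 2) (z : ℝ) : pairMeasure ν L p {z} = ENNReal.ofReal (ν p.1 p.2 z) := by
  rw [pairMeasure, Measure.sum_apply _ (measurableSet_singleton z)]
  by_cases hz : z ∈ diffSet L p.1 p.2
  · rw [tsum_eq_single ⟨z, hz⟩]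
    · simp
    · rintro ⟨y, hy⟩ hne
      have : y ≠ z := fun h => hne (Subtype.ext h)
      simp [this]
  · rw [hν _ _ _ hz, ENNReal.ofReal_zero, ENNReal.tsum_eq_zero]
    rintro ⟨y, hy⟩
    have : y ≠ z := fun h => hz (h ▸ hy)
    simp [this]

theorem pairMeasure_compl {D : Set ℝ} (hD : MeasurableSet D) (p : Fin 2 × Fin 2)
    (h : diffSet L p.1 p.2 ⊆ D) : pairMeasure ν L p Dᶜ = 0 := by
  rw [pairMeasure, Measure.sum_apply _ hD.compl, ENNReal.tsum_eq_zero]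
  rintro ⟨y, hy⟩
  simp [h hy]

theorem isLocallyFiniteMeasure_pairMeasure {m : ℕ}
    (hν : ∀ i j z, z ∉ diffSet L i j → ν i j z = 0)
    (hD : ∀ i j, diffSet L i j ⊆ signedLengths m) (p : Fin 2 × Fin 2) :
    IsLocallyFiniteMeasure (pairMeasure ν L p) := by
  refine ⟨fun x => ⟨Set.Icc (-(|x| + 1)) (|x| + 1), Icc_mem_nhds ?_ ?_, ?_⟩⟩
  · linarith [neg_abs_le x]
  · linarith [le_abs_self x]
  · have h0 := pairMeasure_compl (ν := ν) (signedLengths_countable m).measurableSet p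
      (hD p.1 p.2)
    rw [← measure_inter_conull h0, Set.inter_comm, ← Set.biUnion_of_singleton (_ ∩ _)]
    refine measure_biUnion_lt_top (signedLengths_inter_finite m _) fun z _ => ?_
    rw [pairMeasure_singleton hν]
    exact ENNReal.ofReal_lt_top

theorem pairMeasure_eq_convVec {m : ℕ} (hν0 : ∀ i j z, 0 ≤ ν i j z)
    (hν : ∀ i j z, z ∉ diffSet L i j → ν i j z = 0)
    (hD : ∀ i j, (diffSet L i j).Countable)
    (hren : ∀ i j z, ν i j z = (lam m)⁻¹ * ∑ k : Fin 2, ∑ l : Fin 2, ∑ r ∈ T m i k,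
      ∑ s ∈ T m j l, ν k l ((z + r - s) / lam m)) :
    pairMeasure ν L = ENNReal.ofReal (lam m)⁻¹ •
      convVec (kroneckerConv (tilde (deltaT m)) (deltaT m))
        (mapVec (fun x => lam m * x) (pairMeasure ν L)) := by
  have hl := (lam_pos m).ne'
  have hsf := sFinite_pairMeasure (ν := ν) hD
  funext p
  -- A countable set carrying both measures: the difference set for the left side, its affine images
  -- for the right.
  set C : Set ℝ := diffSet L p.1 p.2 ∪ ⋃ q : Fin 2 × Fin 2, ⋃ r ∈ T m p.1 q.1, ⋃ t ∈ T m p.2 q.2,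
    (fun y => -r + t + lam m * y) '' diffSet L q.1 q.2 with hC
  have hCc : C.Countable := (hD _ _).union <| Set.countable_iUnion fun q =>
    (T m p.1 q.1).countable_toSet.biUnion fun r _ =>
      (T m p.2 q.2).countable_toSet.biUnion fun t _ => (hD q.1 q.2).image _
  have hformula : ∀ s : Set ℝ, MeasurableSet s →
      (ENNReal.ofReal (lam m)⁻¹ • convVec (kroneckerConv (tilde (deltaT m)) (deltaT m))
        (mapVec (fun x => lam m * x) (pairMeasure ν L))) p s =
      ENNReal.ofReal (lam m)⁻¹ * ∑ q : Fin 2 × Fin 2, ∑ r ∈ T m p.1 q.1, ∑ t ∈ T m p.2 q.2,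
        pairMeasure ν L q ((fun y => -r + t + lam m * y) ⁻¹' s) := by
    intro s hs
    rw [Pi.smul_apply, Measure.smul_apply, smul_eq_mul, convVec, Measure.finsetSum_apply]
    congr 1
    exact Finset.sum_congr rfl fun q _ => kroneckerConv_conv_apply m p q _ hs
  refine measure_ext_of_countable hCc (pairMeasure_compl hCc.measurableSet p
    Set.subset_union_left) ?_ fun z => ?_
  · rw [hformula _ hCc.measurableSet.compl]
    refine mul_eq_zero_of_right _ (Finset.sum_eq_zero fun q _ => Finset.sum_eq_zero fun r hr =>
      Finset.sum_eq_zero fun t ht => ?_)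
    refine measure_mono_null ?_
      (pairMeasure_compl (ν := ν) (hD q.1 q.2).measurableSet q subset_rfl)
    intro y hy hyD
    refine hy (Or.inr ?_)
    simp only [Set.mem_iUnion]
    exact ⟨q, r, hr, t, ht, y, hyD, rfl⟩
  · have hpre : ∀ r t : ℝ, (fun y => -r + t + lam m * y) ⁻¹' {z} = {(z + r - t) / lam m} := by
      intro r t
      ext y
      simp only [Set.mem_preimage, Set.mem_singleton_iff]
      rw [eq_div_iff hl]
      constructor <;> intro h <;> linarith
    rw [hformula _ (measurableSet_singleton z), pairMeasure_singleton hν, hren,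
      ENNReal.ofReal_mul (inv_nonneg.2 (lam_pos m).le), ← Fintype.sum_prod_type']
    congr 1
    simp only [hpre, pairMeasure_singleton hν]
    rw [ENNReal.ofReal_sum_of_nonneg fun q _ => Finset.sum_nonneg fun r _ =>
      Finset.sum_nonneg fun t _ => hν0 _ _ _]
    refine Finset.sum_congr rfl fun q _ => ?_
    rw [ENNReal.ofReal_sum_of_nonneg fun r _ => Finset.sum_nonneg fun t _ => hν0 _ _ _]
    refine Finset.sum_congr rfl fun r _ => ?_
    rw [ENNReal.ofReal_sum_of_nonneg fun t _ => hν0 _ _ _]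

end Measures

end BinaryInflation

/-! ### Normalising by the tile density. -/

theorem mainTheorem7 (m : ℕ) (hm : 1 ≤ m) :
    ∃ ν : Fin 2 → Fin 2 → ℝ → ℝ,
      BinaryInflation.IsPairCorrelation m ν ∧
      (∀ L ∈ BinaryInflation.hull m, ∀ (i j : Fin 2) (z : ℝ),
        z ∉ BinaryInflation.diffSet L i j → ν i j z = 0) ∧
      (∀ (i j : Fin 2) (z : ℝ),
        ν i j z = (BinaryInflation.lam m)⁻¹ *
          ∑ k : Fin 2, ∑ l : Fin 2,
            ∑ r ∈ BinaryInflation.T m i k, ∑ s ∈ BinaryInflation.T m j l,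
              ν k l ((z + r - s) / BinaryInflation.lam m)) ∧
      (∀ L ∈ BinaryInflation.hull m,
        (∀ p, IsLocallyFiniteMeasure (BinaryInflation.pairMeasure ν L p)) ∧
        BinaryInflation.pairMeasure ν L =
          ENNReal.ofReal (BinaryInflation.lam m)⁻¹ •
            BinaryInflation.convVec
              (BinaryInflation.kroneckerConv
                (BinaryInflation.tilde (BinaryInflation.deltaT m)) (BinaryInflation.deltaT m))
              (BinaryInflation.mapVec (fun x => BinaryInflation.lam m * x)
                (BinaryInflation.pairMeasure ν L))) := by
  obtain ⟨ρ, hρ0, hρ⟩ := BinaryInflation.exists_tile_density hm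
  obtain ⟨η, hη0, hη, hren⟩ := BinaryInflation.exists_pair_density hm
  have hcor : BinaryInflation.IsPairCorrelation m fun i j z => η i j z / ρ := by
    intro L hL i j z
    refine ((hη L hL i j z).div (hρ L hL) hρ0.ne').congr' ?_
    filter_upwards [eventually_gt_atTop 0] with r hr
    rw [BinaryInflation.pairRatio_eq, Pi.div_apply, div_div_div_cancel_right₀ (by positivity)]
  have hvan : ∀ L ∈ BinaryInflation.hull m, ∀ (i j : Fin 2) (z : ℝ),
      z ∉ BinaryInflation.diffSet L i j → η i j z / ρ = 0 := by
    intro L hL i j z hz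
    -- Off the difference set of this particular `L`, every finite ratio is already zero.
    refine tendsto_nhds_unique (hcor L hL i j z) (tendsto_const_nhds.congr fun r => ?_)
    have h : BinaryInflation.pairs (BinaryInflation.cutTyped r L) i j z = ∅ :=
      Set.eq_empty_of_forall_notMem fun x hx =>
        hz ⟨x, hx.1.1, x + z, hx.2.1, by ring⟩
    rw [BinaryInflation.pairRatio_eq, BinaryInflation.pairCount, h]
    simp
  have hren' : ∀ (i j : Fin 2) (z : ℝ), η i j z / ρ = (BinaryInflation.lam m)⁻¹ *
      ∑ k : Fin 2, ∑ l : Fin 2, ∑ r ∈ BinaryInflation.T m i k, ∑ s ∈ BinaryInflation.T m j l,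
        η k l ((z + r - s) / BinaryInflation.lam m) / ρ := by
    intro i j z
    simp only [← Finset.sum_div]
    rw [hren, mul_div_assoc]
  refine ⟨fun i j z => η i j z / ρ, hcor, hvan, hren', fun L hL => ⟨?_, ?_⟩⟩
  · exact BinaryInflation.isLocallyFiniteMeasure_pairMeasure (hvan L hL)
      (BinaryInflation.diffSet_subset hm hL)
  · exact BinaryInflation.pairMeasure_eq_convVec (fun i j z => div_nonneg (hη0 i j z) hρ0.le)
      (hvan L hL) (fun i j => (BinaryInflation.signedLengths_countable m).mono
        (BinaryInflation.diffSet_subset hm hL i j)) hren'
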